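/- Let $\Bbbk$ be a field. Let $\mathcal{TL}_0(\Bbbk)$ be the strict $\Bbbk$-linear monoidal category whose objects are the natural numbers, with unit object $0$ and $m\otimes n=m+n$, and whose morphisms are generated by $\mathrm{cup}\colon 0\to 2$ and $\mathrm{cap}\colon 2\to 0$ subject to the relations $$(\mathrm{cap}\otimes \mathrm{id}_1)\circ(\mathrm{id}_1\otimes \mathrm{cup})=0,\qquad (\mathrm{id}_1\otimes \mathrm{cap})\circ(\mathrm{cup}\otimes \mathrm{id}_1)=0,\qquad \mathrm{cap}\circ\mathrm{cup}=\mathrm{id}_0 .$$ (It is the specialization at $q=0$ of the Temperley--Lieb category normalized so that both zig-zags equal $q\cdot\mathrm{id}_1$ and the circle equals $(q^2+1)\,\mathrm{id}_0$.) Let $\mathbf{CrysTL}$ be the Cauchy completion of $\mathcal{TL}_0(\Bbbk)$, that is, the idempotent completion of its additive envelope, with the monoidal structure extended from $\mathcal{TL}_0(\Bbbk)$. Then the monoidal category $\mathbf{CrysTL}$ does not admit a braiding. -/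

import Mathlib

open CategoryTheory MonoidalCategory

universe u v w

noncomputable section

/-! ## The renormalized Temperley--Lieb category, by generators and relations

All compositions are written in diagrammatic order: `comp f g` is "first `f`, then `g`". -/

/-- Formal expressions for morphisms `m ⟶ n`, built from `cup : 0 ⟶ 2` and `cap : 2 ⟶ 0` with the
operations of a `k`-linear strict monoidal category whose objects are the natural numbers, with
`m ⊗ n = m + n`. -/
inductive TLTerm (k : Type u) : ℕ → ℕ → Type u
  | id (n : ℕ) : TLTerm k n n
  | cup : TLTerm k 0 2
  | cap : TLTerm k 2 0
  | comp {l m n : ℕ} (f : TLTerm k l m) (g : TLTerm k m n) : TLTerm k l n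
  | tensor {m n m' n' : ℕ} (f : TLTerm k m n) (g : TLTerm k m' n') : TLTerm k (m + m') (n + n')
  | zero (m n : ℕ) : TLTerm k m n
  | add {m n : ℕ} (f g : TLTerm k m n) : TLTerm k m n
  | smul {m n : ℕ} (c : k) (f : TLTerm k m n) : TLTerm k m n

namespace TLTerm

/-- The identity of `m = n`, transported along an equality of natural numbers (needed only to
express strict associativity and unitality, as `(l + m) + n` and `l + (m + n)` are not
definitionally equal). -/
def idOfEq (k : Type u) {m n : ℕ} (h : m = n) : TLTerm k m n := h ▸ TLTerm.id m

/-- The congruence on formal expressions generated by the axioms of a `k`-linear strict monoidal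
category and the Temperley--Lieb relations with parameter `a`: both zig-zags equal `a` times the
identity of `1`, and the circle equals `a ^ 2 + 1`. -/
inductive Rel {k : Type u} [Field k] (a : k) : ∀ {m n : ℕ}, TLTerm k m n → TLTerm k m n → Prop
  | refl {m n} (f : TLTerm k m n) : Rel a f f
  | symm {m n} {f g : TLTerm k m n} : Rel a f g → Rel a g f
  | trans {m n} {f g h : TLTerm k m n} : Rel a f g → Rel a g h → Rel a f h
  -- compatibility with the operations
  | comp_congr {l m n} {f f' : TLTerm k l m} {g g' : TLTerm k m n} :
      Rel a f f' → Rel a g g' → Rel a (f.comp g) (f'.comp g')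
  | tensor_congr {m n m' n'} {f f' : TLTerm k m n} {g g' : TLTerm k m' n'} :
      Rel a f f' → Rel a g g' → Rel a (f.tensor g) (f'.tensor g')
  | add_congr {m n} {f f' g g' : TLTerm k m n} :
      Rel a f f' → Rel a g g' → Rel a (f.add g) (f'.add g')
  | smul_congr {m n} (c : k) {f f' : TLTerm k m n} : Rel a f f' → Rel a (f.smul c) (f'.smul c)
  -- the morphisms `m ⟶ n` form a `k`-vector space
  | add_assoc {m n} (f g h : TLTerm k m n) : Rel a ((f.add g).add h) (f.add (g.add h))
  | add_comm {m n} (f g : TLTerm k m n) : Rel a (f.add g) (g.add f)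
  | zero_add {m n} (f : TLTerm k m n) : Rel a ((zero m n).add f) f
  | smul_add {m n} (c : k) (f g : TLTerm k m n) :
      Rel a ((f.add g).smul c) ((f.smul c).add (g.smul c))
  | add_smul {m n} (c d : k) (f : TLTerm k m n) :
      Rel a (f.smul (c + d)) ((f.smul c).add (f.smul d))
  | mul_smul {m n} (c d : k) (f : TLTerm k m n) : Rel a (f.smul (c * d)) ((f.smul d).smul c)
  | one_smul {m n} (f : TLTerm k m n) : Rel a (f.smul 1) f
  | zero_smul {m n} (f : TLTerm k m n) : Rel a (f.smul 0) (zero m n)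
  -- `k`-linear category
  | id_comp {m n} (f : TLTerm k m n) : Rel a ((id m).comp f) f
  | comp_id {m n} (f : TLTerm k m n) : Rel a (f.comp (id n)) f
  | assoc {l m n p} (f : TLTerm k l m) (g : TLTerm k m n) (h : TLTerm k n p) :
      Rel a ((f.comp g).comp h) (f.comp (g.comp h))
  | add_comp {l m n} (f f' : TLTerm k l m) (g : TLTerm k m n) :
      Rel a ((f.add f').comp g) ((f.comp g).add (f'.comp g))
  | comp_add {l m n} (f : TLTerm k l m) (g g' : TLTerm k m n) :
      Rel a (f.comp (g.add g')) ((f.comp g).add (f.comp g'))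
  | smul_comp {l m n} (c : k) (f : TLTerm k l m) (g : TLTerm k m n) :
      Rel a ((f.smul c).comp g) ((f.comp g).smul c)
  | comp_smul {l m n} (c : k) (f : TLTerm k l m) (g : TLTerm k m n) :
      Rel a (f.comp (g.smul c)) ((f.comp g).smul c)
  -- the tensor product is a `k`-bilinear bifunctor
  | id_tensor_id (m n : ℕ) : Rel a ((id m).tensor (id n)) (id (m + n))
  | tensor_comp_tensor {l m n l' m' n'} (f : TLTerm k l m) (f' : TLTerm k l' m')
      (g : TLTerm k m n) (g' : TLTerm k m' n') :
      Rel a ((f.tensor f').comp (g.tensor g')) ((f.comp g).tensor (f'.comp g'))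
  | add_tensor {m n m' n'} (f f' : TLTerm k m n) (g : TLTerm k m' n') :
      Rel a ((f.add f').tensor g) ((f.tensor g).add (f'.tensor g))
  | tensor_add {m n m' n'} (f : TLTerm k m n) (g g' : TLTerm k m' n') :
      Rel a (f.tensor (g.add g')) ((f.tensor g).add (f.tensor g'))
  | smul_tensor {m n m' n'} (c : k) (f : TLTerm k m n) (g : TLTerm k m' n') :
      Rel a ((f.smul c).tensor g) ((f.tensor g).smul c)
  | tensor_smul {m n m' n'} (c : k) (f : TLTerm k m n) (g : TLTerm k m' n') :
      Rel a (f.tensor (g.smul c)) ((f.tensor g).smul c)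
  -- the tensor product is strictly associative and unital
  | tensor_assoc {m n m' n' m'' n''} (f : TLTerm k m n) (g : TLTerm k m' n')
      (h : TLTerm k m'' n'') :
      Rel a (((f.tensor g).tensor h).comp (idOfEq k (Nat.add_assoc n n' n'')))
        ((idOfEq k (Nat.add_assoc m m' m'')).comp (f.tensor (g.tensor h)))
  | id_zero_tensor {m n} (f : TLTerm k m n) :
      Rel a (((id 0).tensor f).comp (idOfEq k (Nat.zero_add n)))
        ((idOfEq k (Nat.zero_add m)).comp f)
  | tensor_id_zero {m n} (f : TLTerm k m n) :
      Rel a ((f.tensor (id 0)).comp (idOfEq k (Nat.add_zero n)))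
        ((idOfEq k (Nat.add_zero m)).comp f)
  -- the Temperley--Lieb relations
  | zigzag_left :
      Rel a (((id 1).tensor cup).comp (cap.tensor (id 1)) : TLTerm k 1 1) ((id 1).smul a)
  | zigzag_right :
      Rel a ((cup.tensor (id 1)).comp ((id 1).tensor cap) : TLTerm k 1 1) ((id 1).smul a)
  | circle : Rel a (cup.comp cap) ((id 0).smul (a ^ 2 + 1))

/-- The congruence as a setoid. -/
def setoid {k : Type u} [Field k] (a : k) (m n : ℕ) : Setoid (TLTerm k m n) :=
  ⟨Rel a, Rel.refl, Rel.symm, Rel.trans⟩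

end TLTerm

/-- The objects of the (renormalized) Temperley--Lieb category over `k` with parameter `a`:
the natural numbers. -/
structure TLCat (k : Type u) [Field k] (a : k) where
  /-- the number of points -/
  n : ℕ

namespace TLCat

variable {k : Type u} [Field k] {a : k}

/-- Morphisms are formal expressions modulo the relations. -/
def Hom (X Y : TLCat k a) : Type u := Quotient (TLTerm.setoid a X.n Y.n)

/-- The morphism represented by a formal expression. -/
def homMk {X Y : TLCat k a} (f : TLTerm k X.n Y.n) : Hom X Y := Quotient.mk (TLTerm.setoid a X.n Y.n) f

theorem homMk_eq {X Y : TLCat k a} {f g : TLTerm k X.n Y.n} (h : TLTerm.Rel a f g) :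
    (homMk f : Hom X Y) = homMk g := Quotient.sound (s := TLTerm.setoid a X.n Y.n) h

theorem homMk_surj {X Y : TLCat k a} (f : Hom X Y) : ∃ t, homMk t = f := Quotient.exists_rep f

/-- Composition, tensor product and linear structure of morphisms, induced from formal
expressions. -/
def Hom.comp {X Y Z : TLCat k a} (f : Hom X Y) (g : Hom Y Z) : Hom X Z :=
  Quotient.map₂ (sa := TLTerm.setoid a X.n Y.n) (sb := TLTerm.setoid a Y.n Z.n)
    (sc := TLTerm.setoid a X.n Z.n)
    TLTerm.comp (fun _ _ h _ _ h' => TLTerm.Rel.comp_congr h h') f g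

instance : Category.{u} (TLCat k a) where
  Hom := Hom
  id X := homMk (TLTerm.id X.n)
  comp := Hom.comp
  id_comp f := by
    obtain ⟨f, rfl⟩ := homMk_surj f
    exact homMk_eq (.id_comp f)
  comp_id f := by
    obtain ⟨f, rfl⟩ := homMk_surj f
    exact homMk_eq (.comp_id f)
  assoc f g h := by
    obtain ⟨f, rfl⟩ := homMk_surj f
    obtain ⟨g, rfl⟩ := homMk_surj g
    obtain ⟨h, rfl⟩ := homMk_surj h
    exact homMk_eq (.assoc f g h)

/-- The morphism of the category represented by a formal expression. -/
def ofTerm {X Y : TLCat k a} (f : TLTerm k X.n Y.n) : X ⟶ Y := homMk f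

theorem ofTerm_eq {X Y : TLCat k a} {f g : TLTerm k X.n Y.n} (h : TLTerm.Rel a f g) :
    (ofTerm f : X ⟶ Y) = ofTerm g := homMk_eq h

theorem ofTerm_surj {X Y : TLCat k a} (f : X ⟶ Y) : ∃ t, ofTerm t = f := homMk_surj f

/-- The linear structure on morphisms. -/
instance (X Y : TLCat k a) : Zero (X ⟶ Y) := ⟨ofTerm (TLTerm.zero X.n Y.n)⟩

instance (X Y : TLCat k a) : Add (X ⟶ Y) :=
  ⟨Quotient.map₂ (sa := TLTerm.setoid a X.n Y.n) (sb := TLTerm.setoid a X.n Y.n)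
    (sc := TLTerm.setoid a X.n Y.n)
    TLTerm.add (fun _ _ h _ _ h' => TLTerm.Rel.add_congr h h')⟩

instance (X Y : TLCat k a) : SMul k (X ⟶ Y) :=
  ⟨fun c => Quotient.map (sa := TLTerm.setoid a X.n Y.n) (sb := TLTerm.setoid a X.n Y.n)
    (TLTerm.smul c) (fun _ _ h => TLTerm.Rel.smul_congr c h)⟩

instance (X Y : TLCat k a) : Neg (X ⟶ Y) := ⟨fun f => (-1 : k) • f⟩

instance (X Y : TLCat k a) : AddCommGroup (X ⟶ Y) where
  add_assoc f g h := by
    obtain ⟨f, rfl⟩ := ofTerm_surj f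
    obtain ⟨g, rfl⟩ := ofTerm_surj g
    obtain ⟨h, rfl⟩ := ofTerm_surj h
    exact ofTerm_eq (.add_assoc f g h)
  add_comm f g := by
    obtain ⟨f, rfl⟩ := ofTerm_surj f
    obtain ⟨g, rfl⟩ := ofTerm_surj g
    exact ofTerm_eq (.add_comm f g)
  zero_add f := by
    obtain ⟨f, rfl⟩ := ofTerm_surj f
    exact ofTerm_eq (.zero_add f)
  add_zero f := by
    obtain ⟨f, rfl⟩ := ofTerm_surj f
    exact ofTerm_eq (.trans (.add_comm _ _) (.zero_add f))
  neg_add_cancel f := by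
    obtain ⟨f, rfl⟩ := ofTerm_surj f
    refine ofTerm_eq (.trans (.add_congr (.refl _) (.symm (.one_smul f))) ?_)
    refine .trans (.symm (.add_smul (-1) 1 f)) ?_
    rw [neg_add_cancel]
    exact .zero_smul f
  nsmul := nsmulRec
  zsmul := zsmulRec

instance : Preadditive (TLCat k a) where
  add_comp _ _ _ f f' g := by
    obtain ⟨f, rfl⟩ := ofTerm_surj f
    obtain ⟨f', rfl⟩ := ofTerm_surj f'
    obtain ⟨g, rfl⟩ := ofTerm_surj g
    exact ofTerm_eq (.add_comp f f' g)
  comp_add _ _ _ f g g' := by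
    obtain ⟨f, rfl⟩ := ofTerm_surj f
    obtain ⟨g, rfl⟩ := ofTerm_surj g
    obtain ⟨g', rfl⟩ := ofTerm_surj g'
    exact ofTerm_eq (.comp_add f g g')

instance (X Y : TLCat k a) : Module k (X ⟶ Y) where
  one_smul f := by
    obtain ⟨f, rfl⟩ := ofTerm_surj f
    exact ofTerm_eq (.one_smul f)
  mul_smul c d f := by
    obtain ⟨f, rfl⟩ := ofTerm_surj f
    exact ofTerm_eq (.mul_smul c d f)
  smul_zero c := ofTerm_eq (.trans (.smul_congr c (.symm (.zero_smul (.zero X.n Y.n))))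
    (.trans (.symm (.mul_smul c 0 _)) (by rw [mul_zero]; exact .zero_smul _)))
  smul_add c f g := by
    obtain ⟨f, rfl⟩ := ofTerm_surj f
    obtain ⟨g, rfl⟩ := ofTerm_surj g
    exact ofTerm_eq (.smul_add c f g)
  add_smul c d f := by
    obtain ⟨f, rfl⟩ := ofTerm_surj f
    exact ofTerm_eq (.add_smul c d f)
  zero_smul f := by
    obtain ⟨f, rfl⟩ := ofTerm_surj f
    exact ofTerm_eq (.zero_smul f)

instance : Linear k (TLCat k a) where
  smul_comp _ _ _ c f g := by
    obtain ⟨f, rfl⟩ := ofTerm_surj f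
    obtain ⟨g, rfl⟩ := ofTerm_surj g
    exact ofTerm_eq (.smul_comp c f g)
  comp_smul _ _ _ f c g := by
    obtain ⟨f, rfl⟩ := ofTerm_surj f
    obtain ⟨g, rfl⟩ := ofTerm_surj g
    exact ofTerm_eq (.comp_smul c f g)

/-- The tensor product of morphisms. -/
def tensorMor {X Y X' Y' : TLCat k a} (f : X ⟶ Y) (g : X' ⟶ Y') :
    (⟨X.n + X'.n⟩ : TLCat k a) ⟶ ⟨Y.n + Y'.n⟩ :=
  Quotient.map₂ (sa := TLTerm.setoid a X.n Y.n) (sb := TLTerm.setoid a X'.n Y'.n)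
    (sc := TLTerm.setoid a (X.n + X'.n) (Y.n + Y'.n))
    TLTerm.tensor (fun _ _ h _ _ h' => TLTerm.Rel.tensor_congr h h') f g

/-- The objects given by equal natural numbers are equal. -/
theorem obj_eq {m n : ℕ} (h : m = n) : (⟨m⟩ : TLCat k a) = ⟨n⟩ := congrArg _ h

theorem eqToHom_obj_eq {m n : ℕ} (h : m = n) :
    eqToHom (obj_eq h : (⟨m⟩ : TLCat k a) = ⟨n⟩) = ofTerm (TLTerm.idOfEq k h) := by
  subst h; rfl

theorem id_tensorMor_id (X Y : TLCat k a) : tensorMor (𝟙 X) (𝟙 Y) = 𝟙 (⟨X.n + Y.n⟩ : TLCat k a) :=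
  ofTerm_eq (.id_tensor_id X.n Y.n)

theorem tensorMor_eqToHom (X : TLCat k a) {Y Z : TLCat k a} (h : Y = Z) :
    tensorMor (𝟙 X) (eqToHom h) = eqToHom (by rw [h]) := by
  subst h; exact id_tensorMor_id _ _

theorem eqToHom_tensorMor {Y Z : TLCat k a} (h : Y = Z) (X : TLCat k a) :
    tensorMor (eqToHom h) (𝟙 X) = eqToHom (by rw [h]) := by
  subst h; exact id_tensorMor_id _ _

theorem tensorMor_comp {X Y Z X' Y' Z' : TLCat k a} (f : X ⟶ Y) (f' : X' ⟶ Y')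
    (g : Y ⟶ Z) (g' : Y' ⟶ Z') :
    tensorMor f f' ≫ tensorMor g g' = tensorMor (f ≫ g) (f' ≫ g') := by
  obtain ⟨f, rfl⟩ := ofTerm_surj f
  obtain ⟨g, rfl⟩ := ofTerm_surj g
  obtain ⟨f', rfl⟩ := ofTerm_surj f'
  obtain ⟨g', rfl⟩ := ofTerm_surj g'
  exact ofTerm_eq (.tensor_comp_tensor f f' g g')

theorem tensorMor_assoc {X Y Z X' Y' Z' : TLCat k a} (f : X ⟶ X') (g : Y ⟶ Y') (h : Z ⟶ Z') :
    tensorMor (tensorMor f g) h ≫ eqToHom (obj_eq (Nat.add_assoc X'.n Y'.n Z'.n)) =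
      eqToHom (obj_eq (Nat.add_assoc X.n Y.n Z.n)) ≫ tensorMor f (tensorMor g h) := by
  obtain ⟨f, rfl⟩ := ofTerm_surj f
  obtain ⟨g, rfl⟩ := ofTerm_surj g
  obtain ⟨h, rfl⟩ := ofTerm_surj h
  rw [eqToHom_obj_eq (Nat.add_assoc X.n Y.n Z.n), eqToHom_obj_eq (Nat.add_assoc X'.n Y'.n Z'.n)]
  exact ofTerm_eq (.tensor_assoc f g h)

theorem id_zero_tensorMor {X Y : TLCat k a} (f : X ⟶ Y) :
    tensorMor (𝟙 (⟨0⟩ : TLCat k a)) f ≫ eqToHom (obj_eq (Nat.zero_add Y.n)) =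
      eqToHom (obj_eq (Nat.zero_add X.n)) ≫ f := by
  obtain ⟨f, rfl⟩ := ofTerm_surj f
  rw [eqToHom_obj_eq (Nat.zero_add X.n), eqToHom_obj_eq (Nat.zero_add Y.n)]
  exact ofTerm_eq (.id_zero_tensor f)

theorem tensorMor_id_zero {X Y : TLCat k a} (f : X ⟶ Y) :
    tensorMor f (𝟙 (⟨0⟩ : TLCat k a)) ≫ eqToHom (obj_eq (Nat.add_zero Y.n)) =
      eqToHom (obj_eq (Nat.add_zero X.n)) ≫ f := by
  obtain ⟨f, rfl⟩ := ofTerm_surj f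
  rw [eqToHom_obj_eq (Nat.add_zero X.n), eqToHom_obj_eq (Nat.add_zero Y.n)]
  exact ofTerm_eq (.tensor_id_zero f)

theorem tensorMor_pentagon (W X Y Z : TLCat k a) :
    tensorMor (eqToHom (obj_eq (Nat.add_assoc W.n X.n Y.n))) (𝟙 Z) ≫
        eqToHom (obj_eq (Nat.add_assoc W.n (X.n + Y.n) Z.n)) ≫
          tensorMor (𝟙 W) (eqToHom (obj_eq (Nat.add_assoc X.n Y.n Z.n))) =
      eqToHom (obj_eq (Nat.add_assoc (W.n + X.n) Y.n Z.n)) ≫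
        eqToHom (obj_eq (Nat.add_assoc W.n X.n (Y.n + Z.n))) := by
  rw [eqToHom_tensorMor, tensorMor_eqToHom, eqToHom_trans, eqToHom_trans, eqToHom_trans]

theorem tensorMor_triangle (X Y : TLCat k a) :
    eqToHom (obj_eq (Nat.add_assoc X.n 0 Y.n)) ≫
        tensorMor (𝟙 X) (eqToHom (obj_eq (Nat.zero_add Y.n))) =
      tensorMor (eqToHom (obj_eq (Nat.add_zero X.n))) (𝟙 Y) := by
  rw [eqToHom_tensorMor, tensorMor_eqToHom, eqToHom_trans]

/-- The strict monoidal structure, `m ⊗ n = m + n`: the associator and the unitors are identities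
(up to the propositional equality of their source and target). -/
instance : MonoidalCategoryStruct (TLCat k a) where
  tensorObj X Y := ⟨X.n + Y.n⟩
  tensorHom f g := tensorMor f g
  whiskerLeft X _ _ f := tensorMor (𝟙 X) f
  whiskerRight f Y := tensorMor f (𝟙 Y)
  tensorUnit := ⟨0⟩
  associator X Y Z := eqToIso (obj_eq (Nat.add_assoc X.n Y.n Z.n))
  leftUnitor X := eqToIso (obj_eq (Nat.zero_add X.n))
  rightUnitor X := eqToIso (obj_eq (Nat.add_zero X.n))

instance : MonoidalCategory (TLCat k a) :=
  MonoidalCategory.ofTensorHom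
    (id_tensorHom_id := id_tensorMor_id)
    (id_tensorHom := fun _ _ _ _ => rfl)
    (tensorHom_id := fun _ _ => rfl)
    (tensorHom_comp_tensorHom := tensorMor_comp)
    (associator_naturality := tensorMor_assoc)
    (leftUnitor_naturality := id_zero_tensorMor)
    (rightUnitor_naturality := tensorMor_id_zero)
    (pentagon := tensorMor_pentagon)
    (triangle := tensorMor_triangle)

theorem add_tensorMor {X Y X' Y' : TLCat k a} (f f' : X ⟶ Y) (g : X' ⟶ Y') :
    tensorMor (f + f') g = tensorMor f g + tensorMor f' g := by
  obtain ⟨f, rfl⟩ := ofTerm_surj f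
  obtain ⟨f', rfl⟩ := ofTerm_surj f'
  obtain ⟨g, rfl⟩ := ofTerm_surj g
  exact ofTerm_eq (.add_tensor f f' g)

theorem tensorMor_add {X Y X' Y' : TLCat k a} (f : X ⟶ Y) (g g' : X' ⟶ Y') :
    tensorMor f (g + g') = tensorMor f g + tensorMor f g' := by
  obtain ⟨f, rfl⟩ := ofTerm_surj f
  obtain ⟨g, rfl⟩ := ofTerm_surj g
  obtain ⟨g', rfl⟩ := ofTerm_surj g'
  exact ofTerm_eq (.tensor_add f g g')

instance : MonoidalPreadditive (TLCat k a) where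
  whiskerLeft_zero {X Y Z} := by
    have h := tensorMor_add (𝟙 X) (0 : Y ⟶ Z) 0
    rw [add_zero] at h
    exact left_eq_add.mp h
  zero_whiskerRight {X Y Z} := by
    have h := add_tensorMor (0 : Y ⟶ Z) 0 (𝟙 X)
    rw [add_zero] at h
    exact left_eq_add.mp h
  whiskerLeft_add f g := tensorMor_add _ f g
  add_whiskerRight f g := add_tensorMor f g _

instance : MonoidalLinear k (TLCat k a) where
  whiskerLeft_smul X _ _ c f := by
    obtain ⟨f, rfl⟩ := ofTerm_surj f
    exact ofTerm_eq (.tensor_smul c (.id X.n) f)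
  smul_whiskerRight c _ _ f X := by
    obtain ⟨f, rfl⟩ := ofTerm_surj f
    exact ofTerm_eq (.smul_tensor c f (.id X.n))

end TLCat

/-- The category `TL₀(k)`: the renormalized Temperley--Lieb category at parameter `0`. Thus both
zig-zags are `0` and the circle is the identity of the unit object. -/
abbrev TL₀ (k : Type u) [Field k] : Type := TLCat k (0 : k)

/-! ## The monoidal structure on the additive envelope `Mat_ C`

The tensor product of `(X i)_{i ∈ I}` and `(Y j)_{j ∈ J}` is `(X i ⊗ Y j)_{(i, j) ∈ I × J}`, and
the tensor product of matrices is the Kronecker product. -/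

namespace MatTensor

variable {C : Type v} [Category.{w} C] [Preadditive C]

open scoped Classical in
/-- The generalized permutation matrix of a bijection `e` of the index sets and isomorphisms
`X i ≅ Y (e i)`. -/
def permHom {M N : Mat_ C} (e : M.ι ≃ N.ι) (φ : ∀ i, M.X i ≅ N.X (e i)) : M ⟶ N :=
  fun i j => if h : e i = j then (φ i).hom ≫ eqToHom (congrArg N.X h) else 0

open scoped Classical in
/-- The inverse of the generalized permutation matrix. -/
def permInv {M N : Mat_ C} (e : M.ι ≃ N.ι) (φ : ∀ i, M.X i ≅ N.X (e i)) : N ⟶ M :=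
  fun j i => if h : e i = j then eqToHom (congrArg N.X h.symm) ≫ (φ i).inv else 0

theorem permHom_self {M N : Mat_ C} (e : M.ι ≃ N.ι) (φ : ∀ i, M.X i ≅ N.X (e i)) (i : M.ι) :
    permHom e φ i (e i) = (φ i).hom := by
  simp [permHom]

theorem permHom_ne {M N : Mat_ C} (e : M.ι ≃ N.ι) (φ : ∀ i, M.X i ≅ N.X (e i)) {i : M.ι}
    {j : N.ι} (h : e i ≠ j) : permHom e φ i j = 0 := by
  simp [permHom, h]

theorem permInv_self {M N : Mat_ C} (e : M.ι ≃ N.ι) (φ : ∀ i, M.X i ≅ N.X (e i)) (i : M.ι) :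
    permInv e φ (e i) i = (φ i).inv := by
  simp [permInv]

theorem permInv_ne {M N : Mat_ C} (e : M.ι ≃ N.ι) (φ : ∀ i, M.X i ≅ N.X (e i)) {i : M.ι}
    {j : N.ι} (h : e i ≠ j) : permInv e φ j i = 0 := by
  simp [permInv, h]

theorem permHom_comp {M N K : Mat_ C} (e : M.ι ≃ N.ι) (φ : ∀ i, M.X i ≅ N.X (e i)) (g : N ⟶ K)
    (i : M.ι) (j : K.ι) : (permHom e φ ≫ g) i j = (φ i).hom ≫ g (e i) j := by
  rw [Mat_.comp_apply, Finset.sum_eq_single (e i)]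
  · rw [permHom_self]
  · intro b _ hb
    rw [permHom_ne e φ hb.symm, Limits.zero_comp]
  · simp

theorem comp_permHom {M N K : Mat_ C} (e : M.ι ≃ N.ι) (φ : ∀ i, M.X i ≅ N.X (e i)) (g : K ⟶ M)
    (i : K.ι) (j : M.ι) : (g ≫ permHom e φ) i (e j) = g i j ≫ (φ j).hom := by
  rw [Mat_.comp_apply, Finset.sum_eq_single j]
  · rw [permHom_self]
  · intro b _ hb
    rw [permHom_ne e φ (fun h => hb (e.injective h)), Limits.comp_zero]
  · simp

/-- The generalized permutation matrix as an isomorphism. -/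
def permIso {M N : Mat_ C} (e : M.ι ≃ N.ι) (φ : ∀ i, M.X i ≅ N.X (e i)) : M ≅ N where
  hom := permHom e φ
  inv := permInv e φ
  hom_inv_id := by
    apply Mat_.hom_ext
    intro i j
    rw [permHom_comp]
    by_cases h : i = j
    · subst h
      rw [permInv_self, Mat_.id_apply_self, Iso.hom_inv_id]
    · rw [permInv_ne e φ (fun h' => h (e.injective h').symm), Mat_.id_apply_of_ne _ _ _ h,
        Limits.comp_zero]
  inv_hom_id := by
    apply Mat_.hom_ext
    intro i j
    obtain ⟨j, rfl⟩ := e.surjective j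
    rw [comp_permHom]
    by_cases h : i = e j
    · subst h
      rw [permInv_self, Mat_.id_apply_self, Iso.inv_hom_id]
    · rw [permInv_ne e φ (fun h' => h h'.symm), Mat_.id_apply_of_ne _ _ _ h, Limits.zero_comp]

/-- The family of identities. -/
def idFam (M : Mat_ C) (i : M.ι) : M.X i ≅ M.X (Equiv.refl M.ι i) := Iso.refl (M.X i)

theorem id_eq_permHom (M : Mat_ C) : 𝟙 M = permHom (Equiv.refl M.ι) (idFam M) := by
  apply Mat_.hom_ext
  intro i j
  by_cases h : i = j
  · subst h
    rw [Mat_.id_apply_self]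
    exact (permHom_self (Equiv.refl M.ι) (idFam M) i).symm
  · rw [Mat_.id_apply_of_ne _ _ _ h]
    exact (permHom_ne (Equiv.refl M.ι) (idFam M) h).symm

/-- The family of composites of isomorphisms. -/
def compFam {M N K : Mat_ C} (e : M.ι ≃ N.ι) (φ : ∀ i, M.X i ≅ N.X (e i))
    (e' : N.ι ≃ K.ι) (φ' : ∀ i, N.X i ≅ K.X (e' i)) (i : M.ι) :
    M.X i ≅ K.X ((e.trans e') i) := φ i ≪≫ φ' (e i)

theorem permHom_comp_permHom {M N K : Mat_ C} (e : M.ι ≃ N.ι) (φ : ∀ i, M.X i ≅ N.X (e i))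
    (e' : N.ι ≃ K.ι) (φ' : ∀ i, N.X i ≅ K.X (e' i)) :
    permHom e φ ≫ permHom e' φ' = permHom (e.trans e') (compFam e φ e' φ') := by
  apply Mat_.hom_ext
  intro i j
  rw [permHom_comp]
  by_cases h : e' (e i) = j
  · subst h
    rw [permHom_self]
    exact (permHom_self (e.trans e') (compFam e φ e' φ') i).symm
  · rw [permHom_ne _ _ h, permHom_ne _ _ (show (e.trans e') i ≠ j from h), Limits.comp_zero]

variable [MonoidalCategory C]

/-- The tensor product of finite families of objects. -/
abbrev tens (M N : Mat_ C) : Mat_ C := ⟨M.ι × N.ι, fun p => M.X p.1 ⊗ N.X p.2⟩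

/-- The unit: the one-element family consisting of the unit object. -/
abbrev unit (C : Type v) [Category.{w} C] [Preadditive C] [MonoidalCategory C] : Mat_ C :=
  ⟨Unit, fun _ => 𝟙_ C⟩

/-- The Kronecker product of matrices. -/
def kron {M N M' N' : Mat_ C} (f : M ⟶ N) (g : M' ⟶ N') : tens M M' ⟶ tens N N' :=
  fun p q => f p.1 q.1 ⊗ₘ g p.2 q.2

/-- The family of associators of `C`. -/
def assocFam (M N K : Mat_ C) (p : (tens (tens M N) K).ι) :
    (tens (tens M N) K).X p ≅ (tens M (tens N K)).X (Equiv.prodAssoc M.ι N.ι K.ι p) :=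
  α_ (M.X p.1.1) (N.X p.1.2) (K.X p.2)

/-- The family of left unitors of `C`. -/
def leftFam (M : Mat_ C) (p : (tens (unit C) M).ι) :
    (tens (unit C) M).X p ≅ M.X (Equiv.punitProd M.ι p) := λ_ (M.X p.2)

/-- The family of right unitors of `C`. -/
def rightFam (M : Mat_ C) (p : (tens M (unit C)).ι) :
    (tens M (unit C)).X p ≅ M.X (Equiv.prodPUnit M.ι p) := ρ_ (M.X p.1)

/-- The associator. -/
def assocIso (M N K : Mat_ C) : tens (tens M N) K ≅ tens M (tens N K) :=
  permIso (Equiv.prodAssoc M.ι N.ι K.ι) (assocFam M N K)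

/-- The left unitor. -/
def leftIso (M : Mat_ C) : tens (unit C) M ≅ M := permIso (Equiv.punitProd M.ι) (leftFam M)

/-- The right unitor. -/
def rightIso (M : Mat_ C) : tens M (unit C) ≅ M := permIso (Equiv.prodPUnit M.ι) (rightFam M)

theorem assocIso_hom (M N K : Mat_ C) : (assocIso M N K).hom =
    permHom (M := tens (tens M N) K) (N := tens M (tens N K))
      (Equiv.prodAssoc M.ι N.ι K.ι) (assocFam M N K) := rfl

theorem leftIso_hom (M : Mat_ C) : (leftIso M).hom =
    permHom (M := tens (unit C) M) (Equiv.punitProd M.ι) (leftFam M) := rfl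

theorem rightIso_hom (M : Mat_ C) : (rightIso M).hom =
    permHom (M := tens M (unit C)) (Equiv.prodPUnit M.ι) (rightFam M) := rfl

instance : MonoidalCategoryStruct (Mat_ C) where
  tensorObj := tens
  tensorHom f g := kron f g
  whiskerLeft M _ _ f := kron (𝟙 M) f
  whiskerRight f N := kron f (𝟙 N)
  tensorUnit := unit C
  associator := assocIso
  leftUnitor := leftIso
  rightUnitor := rightIso

theorem assoc_naturality {M₁ M₂ M₃ N₁ N₂ N₃ : Mat_ C} (f : M₁ ⟶ N₁) (g : M₂ ⟶ N₂)
    (h : M₃ ⟶ N₃) :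
    kron (kron f g) h ≫ (assocIso N₁ N₂ N₃).hom = (assocIso M₁ M₂ M₃).hom ≫ kron f (kron g h) := by
  rw [assocIso_hom, assocIso_hom]
  apply Mat_.hom_ext
  rintro ⟨⟨i₁, i₂⟩, i₃⟩ ⟨j₁, j₂, j₃⟩
  have h₁ := comp_permHom (M := tens (tens N₁ N₂) N₃) (N := tens N₁ (tens N₂ N₃))
    (Equiv.prodAssoc N₁.ι N₂.ι N₃.ι) (assocFam N₁ N₂ N₃)
    (kron (kron f g) h) ((i₁, i₂), i₃) ((j₁, j₂), j₃)
  have h₂ := permHom_comp (M := tens (tens M₁ M₂) M₃) (N := tens M₁ (tens M₂ M₃))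
    (Equiv.prodAssoc M₁.ι M₂.ι M₃.ι) (assocFam M₁ M₂ M₃)
    (kron f (kron g h)) ((i₁, i₂), i₃) (j₁, j₂, j₃)
  exact h₁.trans ((MonoidalCategory.associator_naturality (f i₁ j₁) (g i₂ j₂) (h i₃ j₃)).trans
    h₂.symm)

theorem left_naturality {M N : Mat_ C} (f : M ⟶ N) :
    kron (𝟙 (unit C)) f ≫ (leftIso N).hom = (leftIso M).hom ≫ f := by
  rw [leftIso_hom, leftIso_hom]
  apply Mat_.hom_ext
  rintro ⟨⟨⟩, i⟩ j
  have h₁ := comp_permHom (M := tens (unit C) N) (Equiv.punitProd N.ι) (leftFam N)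
    (kron (𝟙 (unit C)) f) ((), i) ((), j)
  have h₂ := permHom_comp (M := tens (unit C) M) (Equiv.punitProd M.ι) (leftFam M)
    f ((), i) j
  have h₃ : kron (𝟙 (unit C)) f ((), i) ((), j) = 𝟙_ C ◁ f i j := by
    simp [kron]
  rw [h₃] at h₁
  exact h₁.trans ((MonoidalCategory.leftUnitor_naturality (f i j)).trans h₂.symm)

theorem right_naturality {M N : Mat_ C} (f : M ⟶ N) :
    kron f (𝟙 (unit C)) ≫ (rightIso N).hom = (rightIso M).hom ≫ f := by
  rw [rightIso_hom, rightIso_hom]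
  apply Mat_.hom_ext
  rintro ⟨i, ⟨⟩⟩ j
  have h₁ := comp_permHom (M := tens N (unit C)) (Equiv.prodPUnit N.ι) (rightFam N)
    (kron f (𝟙 (unit C))) (i, ()) (j, ())
  have h₂ := permHom_comp (M := tens M (unit C)) (Equiv.prodPUnit M.ι) (rightFam M)
    f (i, ()) j
  have h₃ : kron f (𝟙 (unit C)) (i, ()) (j, ()) = f i j ▷ 𝟙_ C := by
    simp [kron]
  rw [h₃] at h₁
  exact h₁.trans ((MonoidalCategory.rightUnitor_naturality (f i j)).trans h₂.symm)

variable [MonoidalPreadditive C]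

theorem kron_id_id (M N : Mat_ C) : kron (𝟙 M) (𝟙 N) = 𝟙 _ := by
  apply Mat_.hom_ext
  rintro ⟨i, i'⟩ ⟨j, j'⟩
  by_cases h : i = j
  · subst h
    by_cases h' : i' = j'
    · subst h'
      simp [kron]
    · rw [Mat_.id_apply_of_ne _ _ _ (fun e => h' (congrArg Prod.snd e))]
      simp [kron, h']
  · rw [Mat_.id_apply_of_ne _ _ _ (fun e => h (congrArg Prod.fst e))]
    simp [kron, h]

theorem kron_comp {M N K M' N' K' : Mat_ C} (f : M ⟶ N) (f' : M' ⟶ N') (g : N ⟶ K)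
    (g' : N' ⟶ K') : kron f f' ≫ kron g g' = kron (f ≫ g) (f' ≫ g') := by
  apply Mat_.hom_ext
  rintro ⟨i, i'⟩ ⟨j, j'⟩
  simp only [Mat_.comp_apply, kron, tensor_sum, sum_tensor, tensorHom_comp_tensorHom]
  rw [Fintype.sum_prod_type, Finset.sum_comm]

/-- The family of tensor products of isomorphisms. -/
def tensFam {M N M' N' : Mat_ C} (e : M.ι ≃ N.ι) (φ : ∀ i, M.X i ≅ N.X (e i))
    (e' : M'.ι ≃ N'.ι) (φ' : ∀ i, M'.X i ≅ N'.X (e' i)) (p : (tens M M').ι) :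
    (tens M M').X p ≅ (tens N N').X (Equiv.prodCongr e e' p) :=
  φ p.1 ⊗ᵢ φ' p.2

theorem kron_permHom {M N M' N' : Mat_ C} (e : M.ι ≃ N.ι) (φ : ∀ i, M.X i ≅ N.X (e i))
    (e' : M'.ι ≃ N'.ι) (φ' : ∀ i, M'.X i ≅ N'.X (e' i)) :
    kron (permHom e φ) (permHom e' φ') =
      permHom (M := tens M M') (N := tens N N')
        (Equiv.prodCongr e e') (tensFam e φ e' φ') := by
  apply Mat_.hom_ext
  rintro ⟨i, i'⟩ ⟨j, j'⟩
  by_cases h₁ : e i = j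
  · subst h₁
    by_cases h₂ : e' i' = j'
    · subst h₂
      refine Eq.trans ?_ (permHom_self (M := tens M M') (N := tens N N')
        (Equiv.prodCongr e e') (tensFam e φ e' φ') (i, i')).symm
      simp only [kron, permHom_self]
      rfl
    · rw [permHom_ne _ _ (fun h => h₂ (congrArg Prod.snd h))]
      simp [kron, permHom_ne e' φ' h₂]
  · rw [permHom_ne _ _ (fun h => h₁ (congrArg Prod.fst h))]
    simp [kron, permHom_ne e φ h₁]

theorem pentagon (W X Y Z : Mat_ C) :
    kron (assocIso W X Y).hom (𝟙 Z) ≫ (assocIso W (tens X Y) Z).hom ≫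
        kron (𝟙 W) (assocIso X Y Z).hom =
      (assocIso (tens W X) Y Z).hom ≫ (assocIso W X (tens Y Z)).hom := by
  rw [assocIso_hom, assocIso_hom, assocIso_hom, assocIso_hom, assocIso_hom,
    id_eq_permHom, id_eq_permHom, kron_permHom, kron_permHom, permHom_comp_permHom,
    permHom_comp_permHom, permHom_comp_permHom]
  refine congrArg (permHom _) (funext fun p => Iso.ext ?_)
  have h := MonoidalCategory.pentagon (W.X p.1.1.1) (X.X p.1.1.2) (Y.X p.1.2) (Z.X p.2)
  rw [← tensorHom_id, ← id_tensorHom] at h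
  exact h

theorem triangle (X Y : Mat_ C) :
    (assocIso X (unit C) Y).hom ≫ kron (𝟙 X) (leftIso Y).hom = kron (rightIso X).hom (𝟙 Y) := by
  rw [assocIso_hom, leftIso_hom, rightIso_hom, id_eq_permHom, id_eq_permHom, kron_permHom, kron_permHom, permHom_comp_permHom]
  refine congrArg (permHom _) (funext fun p => Iso.ext ?_)
  have h := MonoidalCategory.triangle (X.X p.1.1) (Y.X p.2)
  rw [← tensorHom_id, ← id_tensorHom] at h
  exact h

instance : MonoidalCategory (Mat_ C) :=
  MonoidalCategory.ofTensorHom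
    (id_tensorHom_id := kron_id_id)
    (id_tensorHom := fun _ _ _ _ => rfl)
    (tensorHom_id := fun _ _ => rfl)
    (tensorHom_comp_tensorHom := kron_comp)
    (associator_naturality := assoc_naturality)
    (leftUnitor_naturality := left_naturality)
    (rightUnitor_naturality := right_naturality)
    (pentagon := pentagon)
    (triangle := triangle)

end MatTensor

/-! ## The monoidal structure on the idempotent completion `Karoubi D`

`(X, p) ⊗ (Y, q) = (X ⊗ Y, p ⊗ q)`, with unit `(𝟙_ D, 𝟙)`. -/

namespace KaroubiTensor

open Idempotents

variable {D : Type v} [Category.{w} D] [MonoidalCategory D]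

/-- The tensor product of objects. -/
abbrev tens (P Q : Karoubi D) : Karoubi D :=
  ⟨P.X ⊗ Q.X, P.p ⊗ₘ Q.p, by rw [tensorHom_comp_tensorHom, P.idem, Q.idem]⟩

/-- The unit. -/
abbrev unit (D : Type v) [Category.{w} D] [MonoidalCategory D] : Karoubi D :=
  ⟨𝟙_ D, 𝟙 _, Category.comp_id _⟩

/-- The tensor product of morphisms. -/
abbrev tensMor {P Q P' Q' : Karoubi D} (f : P ⟶ Q) (g : P' ⟶ Q') : tens P P' ⟶ tens Q Q' :=
  ⟨f.f ⊗ₘ g.f, by simp only [tensorHom_comp_tensorHom, f.comm, g.comm]⟩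

/-- An isomorphism of the underlying objects compatible with the idempotents. -/
abbrev isoOfComm {P Q : Karoubi D} (e : P.X ≅ Q.X) (h : P.p ≫ e.hom = e.hom ≫ Q.p) : P ≅ Q where
  hom := ⟨P.p ≫ e.hom, by
    rw [Category.assoc, ← h, ← Category.assoc, ← Category.assoc, P.idem, P.idem]⟩
  inv := ⟨e.inv ≫ P.p, by
    have h' : Q.p ≫ e.inv = e.inv ≫ P.p := by
      rw [Iso.comp_inv_eq, Category.assoc, h, Iso.inv_hom_id_assoc]
    rw [Category.assoc, P.idem, ← Category.assoc, h', Category.assoc, P.idem]⟩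
  hom_inv_id := by
    ext
    simp
  inv_hom_id := by
    ext
    simp only [Karoubi.comp_f, Karoubi.id_f, Category.assoc]
    rw [← Category.assoc P.p, P.idem, h, Iso.inv_hom_id_assoc]

/-- The associator. -/
abbrev assocIso (P Q R : Karoubi D) : tens (tens P Q) R ≅ tens P (tens Q R) :=
  isoOfComm (α_ P.X Q.X R.X) (associator_naturality P.p Q.p R.p)

/-- The left unitor. -/
abbrev leftIso (P : Karoubi D) : tens (unit D) P ≅ P :=
  isoOfComm (λ_ P.X) (by simp)

/-- The right unitor. -/
abbrev rightIso (P : Karoubi D) : tens P (unit D) ≅ P :=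
  isoOfComm (ρ_ P.X) (by simp)

instance : MonoidalCategoryStruct (Karoubi D) where
  tensorObj := tens
  tensorHom f g := tensMor f g
  whiskerLeft P _ _ f := tensMor (𝟙 P) f
  whiskerRight f P := tensMor f (𝟙 P)
  tensorUnit := unit D
  associator := assocIso
  leftUnitor := leftIso
  rightUnitor := rightIso

theorem assoc_naturality {P₁ P₂ P₃ Q₁ Q₂ Q₃ : Karoubi D} (f : P₁ ⟶ Q₁) (g : P₂ ⟶ Q₂)
    (h : P₃ ⟶ Q₃) :
    tensMor (tensMor f g) h ≫ (assocIso Q₁ Q₂ Q₃).hom =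
      (assocIso P₁ P₂ P₃).hom ≫ tensMor f (tensMor g h) := by
  ext
  simp only [Karoubi.comp_f, Category.assoc]
  rw [← associator_naturality, ← Category.assoc, ← Category.assoc]
  simp only [tensorHom_comp_tensorHom, Karoubi.comp_p, Karoubi.p_comp]

theorem left_naturality {P Q : Karoubi D} (f : P ⟶ Q) :
    tensMor (𝟙 (unit D)) f ≫ (leftIso Q).hom = (leftIso P).hom ≫ f := by
  ext
  simp

theorem right_naturality {P Q : Karoubi D} (f : P ⟶ Q) :
    tensMor f (𝟙 (unit D)) ≫ (rightIso Q).hom = (rightIso P).hom ≫ f := by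
  ext
  simp

theorem comp_tensor_eq {X Y Z W V : D} (a : X ⟶ Y) (b : Y ⟶ Z) (c : W ⟶ V) :
    (a ≫ b ⊗ₘ c) = (a ⊗ₘ c) ≫ b ▷ V := by
  rw [← tensorHom_id, tensorHom_comp_tensorHom, Category.comp_id]

theorem tensor_comp_eq {X Y Z W V : D} (a : X ⟶ Y) (b : Y ⟶ Z) (c : W ⟶ V) :
    (c ⊗ₘ a ≫ b) = (c ⊗ₘ a) ≫ V ◁ b := by
  rw [← id_tensorHom, tensorHom_comp_tensorHom, Category.comp_id]

theorem pentagon (W X Y Z : Karoubi D) :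
    tensMor (assocIso W X Y).hom (𝟙 Z) ≫ (assocIso W (tens X Y) Z).hom ≫
        tensMor (𝟙 W) (assocIso X Y Z).hom =
      (assocIso (tens W X) Y Z).hom ≫ (assocIso W X (tens Y Z)).hom := by
  ext
  simp only [Karoubi.comp_f, Karoubi.id_f, Category.assoc]
  have h : (α_ W.X X.X Y.X).hom ▷ Z.X ≫ ((W.p ⊗ₘ X.p ⊗ₘ Y.p) ⊗ₘ Z.p) =
      (((W.p ⊗ₘ X.p) ⊗ₘ Y.p) ⊗ₘ Z.p) ≫ (α_ W.X X.X Y.X).hom ▷ Z.X := by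
    rw [← tensorHom_id, tensorHom_comp_tensorHom, tensorHom_comp_tensorHom,
      associator_naturality, Category.id_comp, Category.comp_id]
  rw [comp_tensor_eq, tensor_comp_eq, ← associator_naturality_assoc,
    ← associator_naturality_assoc, Category.assoc, reassoc_of% h, reassoc_of% h,
    MonoidalCategory.pentagon]
  simp only [tensorHom_comp_tensorHom_assoc, tensorHom_comp_tensorHom, W.idem, X.idem, Y.idem,
    Z.idem]

theorem triangle (X Y : Karoubi D) :
    (assocIso X (unit D) Y).hom ≫ tensMor (𝟙 X) (leftIso Y).hom =
      tensMor (rightIso X).hom (𝟙 Y) := by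
  ext
  simp only [Karoubi.comp_f, Karoubi.id_f, Category.assoc]
  rw [comp_tensor_eq, tensor_comp_eq, ← associator_naturality_assoc, MonoidalCategory.triangle]
  simp only [tensorHom_comp_tensorHom_assoc, tensorHom_comp_tensorHom, X.idem, Y.idem,
    Category.comp_id]

instance : MonoidalCategory (Karoubi D) :=
  MonoidalCategory.ofTensorHom
    (id_tensorHom_id := fun _ _ => rfl)
    (id_tensorHom := fun _ _ _ _ => rfl)
    (tensorHom_id := fun _ _ => rfl)
    (tensorHom_comp_tensorHom := fun f f' g g' =>
      Karoubi.hom_ext _ _ (tensorHom_comp_tensorHom f.f f'.f g.f g'.f))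
    (associator_naturality := assoc_naturality)
    (leftUnitor_naturality := left_naturality)
    (rightUnitor_naturality := right_naturality)
    (pentagon := pentagon)
    (triangle := triangle)

end KaroubiTensor

/-! ## The category `CrysTL` -/

/-- The Cauchy completion of a preadditive category: the idempotent completion of its additive
envelope. -/
abbrev CauchyCompletion (C : Type v) [Category.{w} C] [Preadditive C] :=
  Idempotents.Karoubi (Mat_ C)

/-- The monoidal category `CrysTL`: the Cauchy completion of `TL₀(k)`. -/
abbrev CrysTL (k : Type u) [Field k] := CauchyCompletion (TL₀ k)

end

/-! Represent `TL₀(k)` on the tensor powers of a plane with basis `p`, `q`, written as row vectors: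
the cup creates the word `pq`, and the cap sends `pq` to `1` and the other three words to `0`. A
zig-zag vanishes because its middle letter would have to be both `p` and `q`, and the circle is `1`;
so the relations at parameter `0` hold (`termMat_eq_of_rel`).

This representation is graded by the bicyclic monoid `⟨p, q | pq = 1⟩`: the degree of a word is its
product, and cup and cap preserve degrees because `pq = 1`. Hence the matrix of every morphism
relates only words of equal degree (`isGraded_termMat`). Since `qp ≠ 1`, the grading is sensitive to
the order of the letters.

Suppose there is a braiding, and let `β` be its component on two copies of the generator. Naturality
with respect to the cup and one hexagon write `cup ⊗ 1`, up to the braiding with the unit, as `1 ⊗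
cup`, then `β ⊗ 1`, then `1 ⊗ β` (`cup_whiskerRight_eq`). On the right-hand side, `1 ⊗ cup` yields
words `xpq`, and `β ⊗ 1` leaves their last letter `q` alone. By the grading, `1 ⊗ β` can reach a
word ending in `qp` only from one whose last two letters have degree `qp`, hence from a word ending
in `p`. So no word ending in `qp` occurs (`mul_apply_eq_zero`). But `cup ⊗ 1` sends `p` to `pqp`
(`cup_tens_one_apply`), a contradiction. -/

noncomputable section

/-! ## Matrices indexed by words in two letters

Words of length `n` in the letters `p` and `q` are functions `Fin n → Bool`, with `true` standing
for `p` and `false` for `q`. They index a basis of the `n`-th tensor power of a plane. -/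

namespace WordMatrix

variable {k : Type u} [Field k]

/-- Matrices whose rows are indexed by words of length `m` and columns by words of length `n`. -/
abbrev WMat (k : Type u) (m n : ℕ) := Matrix (Fin m → Bool) (Fin n → Bool) k

/-- A word of length `m + n` is a word of length `m` followed by a word of length `n`. -/
abbrev split (m n : ℕ) : (Fin (m + n) → Bool) ≃ (Fin m → Bool) × (Fin n → Bool) :=
  (Fin.appendEquiv m n).symm

/-- The tensor product of word matrices. -/
def tens {m n m' n' : ℕ} (A : WMat k m n) (B : WMat k m' n') : WMat k (m + m') (n + n') :=
  (Matrix.kronecker A B).submatrix (split m m') (split n n')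

theorem tens_apply {m n m' n' : ℕ} (A : WMat k m n) (B : WMat k m' n') (w u) :
    tens A B w u = A (fun i => w (Fin.castAdd m' i)) (fun i => u (Fin.castAdd n' i)) *
      B (fun i => w (Fin.natAdd m i)) (fun i => u (Fin.natAdd n i)) := rfl

theorem one_tens_one (m n : ℕ) : tens (1 : WMat k m m) (1 : WMat k n n) = 1 := by
  rw [tens, Matrix.kronecker, Matrix.one_kronecker_one, Matrix.submatrix_one_equiv]

theorem tens_mul_tens {l m n l' m' n' : ℕ} (A : WMat k l m) (A' : WMat k l' m')
    (B : WMat k m n) (B' : WMat k m' n') :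
    tens A A' * tens B B' = tens (A * B) (A' * B') := by
  rw [tens, tens, tens, Matrix.submatrix_mul_equiv]
  exact congrArg (fun M => Matrix.submatrix M _ _) (Matrix.mul_kronecker_mul A B A' B').symm

/-- The identification of words along an equality of lengths. -/
def castMat (k : Type u) [Field k] {m n : ℕ} (h : m = n) : WMat k m n :=
  (1 : WMat k m m).submatrix id (fun u i => u (Fin.cast h i))

theorem mul_castMat {l m n : ℕ} (h : m = n) (A : WMat k l m) :
    A * castMat k h = A.submatrix id (fun u i => u (Fin.cast h i)) := by
  subst h
  exact Matrix.mul_one A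

theorem castMat_mul {l m n : ℕ} (h : l = m) (A : WMat k m n) :
    castMat k h * A = A.submatrix (fun u i => u (Fin.cast h.symm i)) id := by
  subst h
  exact Matrix.one_mul A

/-- Each entry on either side is the same triple product over the same subwords; only the bounds of
the letter positions differ. The casts mirror `TLTerm.idOfEq` in the strictness relations. -/
theorem tens_assoc {m n m' n' m'' n'' : ℕ} (A : WMat k m n) (B : WMat k m' n')
    (C : WMat k m'' n'') :
    tens (tens A B) C * castMat k (Nat.add_assoc n n' n'') =
      castMat k (Nat.add_assoc m m' m'') * tens A (tens B C) := by
  rw [mul_castMat, castMat_mul]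
  ext w u
  simp only [Matrix.submatrix_apply, tens_apply, mul_assoc, id]
  refine congrArg₂ _ ?_ (congrArg₂ _ ?_ ?_) <;> refine congrArg₂ _ ?_ ?_ <;> funext i <;>
    refine congrArg _ (Fin.ext ?_) <;> simp [Nat.add_assoc]

theorem one_tens {m n : ℕ} (A : WMat k m n) :
    tens (1 : WMat k 0 0) A * castMat k (Nat.zero_add n) = castMat k (Nat.zero_add m) * A := by
  rw [mul_castMat, castMat_mul]
  ext w u
  simp only [Matrix.submatrix_apply, tens_apply, id]
  -- There is a single word of length `0`, so the left factor is a diagonal entry of the identity.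
  rw [Subsingleton.elim (fun i => w (Fin.castAdd m i)) fun i => u (Fin.cast (Nat.zero_add n)
    (Fin.castAdd n i)), Matrix.one_apply_eq, one_mul]
  refine congrArg₂ _ ?_ ?_ <;> funext i <;> refine congrArg _ (Fin.ext ?_) <;> simp

theorem tens_one {m n : ℕ} (A : WMat k m n) :
    tens A (1 : WMat k 0 0) * castMat k (Nat.add_zero n) = castMat k (Nat.add_zero m) * A := by
  rw [mul_castMat, castMat_mul]
  ext w u
  simp only [Matrix.submatrix_apply, tens_apply, id]
  rw [Subsingleton.elim (fun i => w (Fin.natAdd m i)) fun i => u (Fin.cast (Nat.add_zero n)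
    (Fin.natAdd n i)), Matrix.one_apply_eq, mul_one]
  rfl

/-! ### Cup and cap on words, and the Temperley–Lieb relations at parameter `0` -/

/-- The row vector `p ⊗ q`. -/
def cupMat (k : Type u) [Field k] : WMat k 0 2 := fun _ u =>
  if u 0 = true ∧ u 1 = false then 1 else 0

/-- The column vector dual to `p ⊗ q`. -/
def capMat (k : Type u) [Field k] : WMat k 2 0 := (cupMat k).transpose

theorem cupMat_ne_zero {w u} (h : cupMat k w u ≠ 0) : u 0 = true ∧ u 1 = false := by
  by_contra hu
  exact h (if_neg hu)

theorem capMat_ne_zero {w u} (h : capMat k w u ≠ 0) : w 0 = true ∧ w 1 = false :=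
  cupMat_ne_zero (w := u) h

/-- Nonvanishing entries of a product come from paths of words, so the vanishing statements below
reduce to following individual letters, with no sums to evaluate. -/
theorem exists_of_mul_ne_zero {l m n : ℕ} {A : WMat k l m} {B : WMat k m n} {w u}
    (h : (A * B) w u ≠ 0) : ∃ v, A w v ≠ 0 ∧ B v u ≠ 0 := by
  rw [Matrix.mul_apply] at h
  obtain ⟨v, -, hv⟩ := Finset.exists_ne_zero_of_sum_ne_zero h
  exact ⟨v, left_ne_zero_of_mul hv, right_ne_zero_of_mul hv⟩

theorem eq_of_one_apply_ne_zero {n : ℕ} {w u : Fin n → Bool}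
    (h : (1 : WMat k n n) w u ≠ 0) : w = u := by
  by_contra hne
  exact h (Matrix.one_apply_ne hne)

/-- The middle letter of the intermediate word of length three is the `p` of the cup and also the
`q` required by the cap. The other zig-zag is the mirror image. -/
theorem zigzag_left_mat :
    (tens (1 : WMat k 1 1) (cupMat k) * tens (capMat k) (1 : WMat k 1 1) : WMat k 1 1) = 0 := by
  ext w u
  by_contra h
  obtain ⟨v, h₁, h₂⟩ := exists_of_mul_ne_zero h
  rw [tens_apply] at h₁ h₂
  have h₃ := (cupMat_ne_zero (right_ne_zero_of_mul h₁)).1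
  have h₄ := (capMat_ne_zero (left_ne_zero_of_mul h₂)).2
  exact Bool.noConfusion (h₃.symm.trans h₄)

theorem zigzag_right_mat :
    (tens (cupMat k) (1 : WMat k 1 1) * tens (1 : WMat k 1 1) (capMat k) : WMat k 1 1) = 0 := by
  ext w u
  by_contra h
  obtain ⟨v, h₁, h₂⟩ := exists_of_mul_ne_zero h
  rw [tens_apply] at h₁ h₂
  have h₃ := (cupMat_ne_zero (left_ne_zero_of_mul h₁)).2
  have h₄ := (capMat_ne_zero (right_ne_zero_of_mul h₂)).1
  exact Bool.noConfusion (h₄.symm.trans h₃)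

theorem circle_mat : cupMat k * capMat k = 1 := by
  ext w u
  rw [Subsingleton.elim w u, Matrix.one_apply_eq, Matrix.mul_apply,
    -- Only the word `pq` contributes to the circle.
    Finset.sum_eq_single ![true, false]]
  · simp [cupMat, capMat]
  · intro v _ hv
    have : ¬(v 0 = true ∧ v 1 = false) := fun h => hv (by
      ext i
      fin_cases i
      · exact h.1
      · exact h.2)
    simp [cupMat, this]
  · simp

/-! ### The grading by the bicyclic monoid -/

/-- The predecessor and successor functions, generating a bicyclic monoid with `p * q = 1`. -/
def letter (b : Bool) : Function.End ℕ := if b then Nat.pred else Nat.succ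

/-- The degree of a word in the bicyclic monoid. -/
def degree {n : ℕ} (w : Fin n → Bool) : Function.End ℕ := (List.ofFn fun i => letter (w i)).prod

theorem degree_add {m n : ℕ} (w : Fin (m + n) → Bool) :
    degree w = degree (fun i => w (Fin.castAdd n i)) * degree (fun i => w (Fin.natAdd m i)) := by
  rw [degree, List.ofFn_add, List.prod_append]
  rfl

theorem degree_two (w : Fin 2 → Bool) : degree w = letter (w 0) * letter (w 1) := by
  simp [degree, List.ofFn_succ]

/-- A matrix is graded if its nonzero entries relate words of the same degree. -/
def IsGraded {m n : ℕ} (A : WMat k m n) : Prop := ∀ w u, A w u ≠ 0 → degree w = degree u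

theorem IsGraded.one (n : ℕ) : IsGraded (1 : WMat k n n) := fun _ _ h =>
  congrArg degree (eq_of_one_apply_ne_zero h)

theorem IsGraded.cup : IsGraded (cupMat k) := fun w u h => by
  obtain ⟨h₀, h₁⟩ := cupMat_ne_zero h
  rw [degree_two, h₀, h₁]
  -- The empty word has degree the identity, and `pq` has degree `Nat.pred ∘ Nat.succ`, which is
  -- definitionally the identity as well.
  rfl

theorem IsGraded.cap : IsGraded (capMat k) := fun w u h => (IsGraded.cup u w h).symm

theorem IsGraded.mul {l m n : ℕ} {A : WMat k l m} {B : WMat k m n} (hA : IsGraded A)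
    (hB : IsGraded B) : IsGraded (A * B) := fun w u h => by
  obtain ⟨v, h₁, h₂⟩ := exists_of_mul_ne_zero h
  exact (hA w v h₁).trans (hB v u h₂)

theorem IsGraded.tens {m n m' n' : ℕ} {A : WMat k m n} {B : WMat k m' n'} (hA : IsGraded A)
    (hB : IsGraded B) : IsGraded (tens A B) := fun w u h => by
  rw [tens_apply] at h
  rw [degree_add, degree_add u, hA _ _ (left_ne_zero_of_mul h), hB _ _ (right_ne_zero_of_mul h)]

theorem IsGraded.zero (m n : ℕ) : IsGraded (0 : WMat k m n) := fun _ _ h => absurd rfl h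

theorem IsGraded.add {m n : ℕ} {A B : WMat k m n} (hA : IsGraded A) (hB : IsGraded B) :
    IsGraded (A + B) := fun w u h => by
  by_cases h' : A w u = 0
  · exact hB w u fun h'' => h (by rw [Matrix.add_apply, h', h'', add_zero])
  · exact hA w u h'

theorem IsGraded.smul {m n : ℕ} (c : k) {A : WMat k m n} (hA : IsGraded A) :
    IsGraded (c • A) := fun w u h => hA w u (right_ne_zero_of_mul h)

/-- A word of length two with the degree of `q p` ends in `p`. -/
theorem eq_true_of_degree_eq {w u : Fin 2 → Bool} (hu₀ : u 0 = false) (hu₁ : u 1 = true)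
    (h : degree w = degree u) : w 1 = true := by
  rw [degree_two, degree_two, hu₀, hu₁] at h
  -- Evaluation at `0` suffices because the predecessor is truncated there: `qp` gives `1`, whereas
  -- the words ending in `q` give `0` (for `pq`) and `2` (for `qq`).
  have h' : letter (w 0) (letter (w 1) 0) = 1 := congrFun h 0
  cases hw : w 1
  · rw [hw] at h'
    cases h₀ : w 0 <;> rw [h₀] at h' <;> simp [letter] at h'
  · rfl

/-! ## The representation of the Temperley--Lieb category at parameter `0` -/

/-- The matrix represented by a formal expression. -/
def termMat : ∀ {m n : ℕ}, TLTerm k m n → WMat k m n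
  | _, _, .id _ => 1
  | _, _, .cup => cupMat k
  | _, _, .cap => capMat k
  | _, _, .comp f g => termMat f * termMat g
  | _, _, .tensor f g => tens (termMat f) (termMat g)
  | _, _, .zero _ _ => 0
  | _, _, .add f g => termMat f + termMat g
  | _, _, .smul c f => c • termMat f

theorem termMat_idOfEq {m n : ℕ} (h : m = n) : termMat (TLTerm.idOfEq k h) = castMat k h := by
  subst h
  rfl

/-- Graded matrices are closed under all the operations, so it is enough that cup and cap are
graded. This is what constrains an otherwise unknown braiding. -/
theorem isGraded_termMat {m n : ℕ} (f : TLTerm k m n) : IsGraded (termMat f) := by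
  induction f with
  | id n => exact .one n
  | cup => exact .cup
  | cap => exact .cap
  | comp f g hf hg => exact hf.mul hg
  | tensor f g hf hg => exact hf.tens hg
  | zero m n => exact .zero m n
  | add f g hf hg => exact hf.add hg
  | smul c f hf => exact hf.smul c

theorem termMat_eq_of_rel {m n : ℕ} {f g : TLTerm k m n} (h : TLTerm.Rel (0 : k) f g) :
    termMat f = termMat g := by
  induction h with
  | refl f => rfl
  | symm _ h => exact h.symm
  | trans _ _ h₁ h₂ => exact h₁.trans h₂
  | comp_congr _ _ h₁ h₂ | tensor_congr _ _ h₁ h₂ | add_congr _ _ h₁ h₂ =>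
    simp only [termMat, h₁, h₂]
  | smul_congr c _ h => simp only [termMat, h]
  | add_assoc f g h => exact _root_.add_assoc _ _ _
  | add_comm f g => exact _root_.add_comm _ _
  | zero_add f => exact _root_.zero_add _
  | smul_add c f g => exact _root_.smul_add _ _ _
  | add_smul c d f => exact _root_.add_smul _ _ _
  | mul_smul c d f => exact SemigroupAction.mul_smul _ _ _
  | one_smul f => exact _root_.one_smul _ _
  | zero_smul f => exact _root_.zero_smul _ _
  | id_comp f => exact Matrix.one_mul _
  | comp_id f => exact Matrix.mul_one _
  | assoc f g h => exact Matrix.mul_assoc _ _ _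
  | add_comp f f' g => exact Matrix.add_mul _ _ _
  | comp_add f g g' => exact Matrix.mul_add _ _ _
  | smul_comp c f g => exact Matrix.smul_mul _ _ _
  | comp_smul c f g => exact Matrix.mul_smul _ _ _
  | id_tensor_id m n => exact one_tens_one m n
  | tensor_comp_tensor f f' g g' => exact tens_mul_tens _ _ _ _
  | add_tensor f f' g => ext w u; exact add_mul _ _ _
  | tensor_add f g g' => ext w u; exact mul_add _ _ _
  | smul_tensor c f g => ext w u; exact mul_assoc _ _ _
  | tensor_smul c f g => ext w u; exact mul_left_comm _ _ _
  | tensor_assoc f g h =>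
    simp only [termMat, termMat_idOfEq]
    exact tens_assoc _ _ _
  | id_zero_tensor f =>
    simp only [termMat, termMat_idOfEq]
    exact one_tens _
  | tensor_id_zero f =>
    simp only [termMat, termMat_idOfEq]
    exact tens_one _
  | zigzag_left =>
    simp only [termMat, _root_.zero_smul]
    exact zigzag_left_mat
  | zigzag_right =>
    simp only [termMat, _root_.zero_smul]
    exact zigzag_right_mat
  | circle =>
    simp only [termMat]
    rw [circle_mat, zero_pow two_ne_zero, _root_.zero_add, _root_.one_smul]

/-- The matrix of a morphism of `TL₀(k)`. -/
def homMat {X Y : TL₀ k} (f : X ⟶ Y) : WMat k X.n Y.n :=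
  Quotient.lift (s := TLTerm.setoid (0 : k) X.n Y.n) termMat (fun _ _ => termMat_eq_of_rel) f

theorem homMat_comp {X Y Z : TL₀ k} (f : X ⟶ Y) (g : Y ⟶ Z) :
    homMat (f ≫ g) = homMat f * homMat g := by
  obtain ⟨f, rfl⟩ := TLCat.ofTerm_surj f
  obtain ⟨g, rfl⟩ := TLCat.ofTerm_surj g
  rfl

theorem homMat_tensorHom {X Y X' Y' : TL₀ k} (f : X ⟶ Y) (g : X' ⟶ Y') :
    homMat (f ⊗ₘ g) = tens (homMat f) (homMat g) := by
  obtain ⟨f, rfl⟩ := TLCat.ofTerm_surj f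
  obtain ⟨g, rfl⟩ := TLCat.ofTerm_surj g
  rfl

theorem isGraded_homMat {X Y : TL₀ k} (f : X ⟶ Y) : IsGraded (homMat f) := by
  obtain ⟨f, rfl⟩ := TLCat.ofTerm_surj f
  exact isGraded_termMat f

/-! ## The matrix of a morphism between one-term objects of `CrysTL` -/

/-- The object of `CrysTL` given by the object `1` of `TL₀(k)`. -/
def gen (k : Type u) [Field k] : CrysTL k := ⟨⟨Unit, fun _ => ⟨1⟩⟩, 𝟙 _, Category.comp_id _⟩

/-- The cup as a morphism of `CrysTL`. -/
def cup (k : Type u) [Field k] : 𝟙_ (CrysTL k) ⟶ gen k ⊗ gen k where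
  f := fun _ _ => TLCat.ofTerm (X := ⟨0⟩) (Y := ⟨2⟩) TLTerm.cup
  comm := by
    have h : (gen k ⊗ gen k).p = 𝟙 _ := MatTensor.kron_id_id _ _
    rw [h]
    exact (Category.id_comp _).trans (Category.comp_id _)

/-- The matrix of the single entry of a morphism between one-term families. -/
def entryMat {P Q : CrysTL k} [Unique P.X.ι] [Unique Q.X.ι] (f : P ⟶ Q) :
    WMat k (P.X.X default).n (Q.X.X default).n :=
  homMat (f.f default default)

/-- With a one-term family in the middle, the sum defining the composite has a single summand. -/
theorem entryMat_comp {P Q R : CrysTL k} [Unique P.X.ι] [Unique Q.X.ι] [Unique R.X.ι]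
    (f : P ⟶ Q) (g : Q ⟶ R) : entryMat (f ≫ g) = entryMat f * entryMat g := by
  rw [entryMat, entryMat, entryMat, ← homMat_comp, Idempotents.Karoubi.comp_f, Mat_.comp_apply,
    Fintype.sum_unique]

instance : Unique (gen k).X.ι := inferInstanceAs (Unique Unit)

instance : Unique (𝟙_ (CrysTL k)).X.ι := inferInstanceAs (Unique Unit)

instance (P Q : CrysTL k) [Unique P.X.ι] [Unique Q.X.ι] : Unique (P ⊗ Q).X.ι where
  default := ((default, default) : P.X.ι × Q.X.ι)
  uniq _ := Prod.ext (Subsingleton.elim _ _) (Subsingleton.elim _ _)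

/-- The factor `entryMat (𝟙 P)` is the matrix of the idempotent of `P`, so it need not be `1`; for
`gen k` it is, by `entryMat_id_gen`. -/
theorem entryMat_whiskerLeft (P : CrysTL k) {Q R : CrysTL k} [Unique P.X.ι] [Unique Q.X.ι]
    [Unique R.X.ι] (f : Q ⟶ R) : entryMat (P ◁ f) = tens (entryMat (𝟙 P)) (entryMat f) :=
  homMat_tensorHom _ _

theorem entryMat_whiskerRight {P Q : CrysTL k} (f : P ⟶ Q) (R : CrysTL k) [Unique P.X.ι]
    [Unique Q.X.ι] [Unique R.X.ι] : entryMat (f ▷ R) = tens (entryMat f) (entryMat (𝟙 R)) :=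
  homMat_tensorHom _ _

theorem entryMat_id_gen : entryMat (𝟙 (gen k)) = 1 :=
  congrArg homMat (Mat_.id_apply_self (gen k).X ())

theorem isGraded_entryMat {P Q : CrysTL k} [Unique P.X.ι] [Unique Q.X.ι] (f : P ⟶ Q) :
    IsGraded (entryMat f) := isGraded_homMat _

/-- Associators in the idempotent completion are composed with the idempotent of the triple product;
here that idempotent is trivial. -/
theorem gen_tensor_p : ((gen k ⊗ gen k) ⊗ gen k).p = 𝟙 _ :=
  (congrArg (MatTensor.kron · _) (MatTensor.kron_id_id _ _)).trans (MatTensor.kron_id_id _ _)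

/-- Both bracketings of three copies of `1` reduce to the object `3`, so the associator of `TL₀(k)`
is an identity here. -/
theorem entryMat_associator_hom :
    entryMat (α_ (gen k) (gen k) (gen k)).hom = (1 : WMat k 3 3) := by
  have h : (α_ (gen k) (gen k) (gen k)).hom.f = (MatTensor.assocIso _ _ _).hom :=
    (congrArg (· ≫ (MatTensor.assocIso (gen k).X (gen k).X (gen k).X).hom) gen_tensor_p).trans
      (Category.id_comp _)
  rw [entryMat, h]
  exact congrArg homMat (MatTensor.permHom_self _
    (MatTensor.assocFam (gen k).X (gen k).X (gen k).X) (((), ()), ()))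

theorem entryMat_associator_inv :
    entryMat (α_ (gen k) (gen k) (gen k)).inv = (1 : WMat k 3 3) := by
  have h : (α_ (gen k) (gen k) (gen k)).inv.f = (MatTensor.assocIso _ _ _).inv :=
    (congrArg ((MatTensor.assocIso (gen k).X (gen k).X (gen k).X).inv ≫ ·) gen_tensor_p).trans
      (Category.comp_id _)
  rw [entryMat, h]
  exact congrArg homMat (MatTensor.permInv_self _
    (MatTensor.assocFam (gen k).X (gen k).X (gen k).X) (((), ()), ()))

/-! ### The contradiction from a braiding -/

/-- Naturality of the braiding along the cup, with the braiding past `gen k ⊗ gen k` expanded by a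
hexagon. -/
theorem cup_whiskerRight_eq [BraidedCategory (CrysTL k)] :
    cup k ▷ gen k = (β_ (gen k) (𝟙_ _)).inv ≫ gen k ◁ cup k ≫ (α_ (gen k) (gen k) (gen k)).inv ≫
      (β_ (gen k) (gen k)).hom ▷ gen k ≫ (α_ (gen k) (gen k) (gen k)).hom ≫
        gen k ◁ (β_ (gen k) (gen k)).hom ≫ (α_ (gen k) (gen k) (gen k)).inv := by
  rw [← BraidedCategory.braiding_tensor_right_hom, BraidedCategory.braiding_naturality_right,
    Iso.inv_hom_id_assoc]


/-- Of the words in the image of the vectors `x p q`, after a matrix acting on the first two letters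
and a graded matrix acting on the last two, none ends in `q p`. -/
theorem mul_apply_eq_zero (S T : WMat k 2 2) (hT : IsGraded T) {w : Fin 1 → Bool}
    {u : Fin 3 → Bool} (hu₁ : u 1 = false) (hu₂ : u 2 = true) :
    ((tens (1 : WMat k 1 1) (cupMat k) : WMat k 1 3) * ((tens S (1 : WMat k 1 1) : WMat k 3 3) *
      (tens (1 : WMat k 1 1) T : WMat k 3 3))) w u = 0 := by
  -- A nonzero entry gives a path through `v`, after the cup, and `v'`, after `S`. The last letter
  -- of `v` is the `q` of the cup and is unchanged in `v'`, while the grading of `T` forces the last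
  -- letter of `v'` to be `p`.
  by_contra h
  obtain ⟨v, hv, h⟩ := exists_of_mul_ne_zero h
  obtain ⟨v', hv', hu⟩ := exists_of_mul_ne_zero h
  rw [tens_apply] at hv hv' hu
  have h₁ : v 2 = false := (cupMat_ne_zero (right_ne_zero_of_mul hv)).2
  have h₂ : v 2 = v' 2 := congrFun (eq_of_one_apply_ne_zero (right_ne_zero_of_mul hv')) 0
  have h₃ : v' 2 = true :=
    eq_true_of_degree_eq (u := fun i => u (Fin.natAdd 1 i)) hu₁ hu₂
      (hT _ _ (right_ne_zero_of_mul hu))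
  exact Bool.noConfusion (h₁.symm.trans (h₂.trans h₃))

theorem cup_tens_one_apply :
    (tens (cupMat k) (1 : WMat k 1 1) : WMat k 1 3) ![true] ![true, false, true] = 1 := by
  have h : (fun i => ![true] (Fin.natAdd 0 i) : Fin 1 → Bool) =
      fun i => ![true, false, true] (Fin.natAdd 2 i) := by
    ext i
    fin_cases i
    rfl
  refine (tens_apply (cupMat k) (1 : WMat k 1 1) _ _).trans ?_
  rw [h, Matrix.one_apply_eq, mul_one]
  exact if_pos ⟨rfl, rfl⟩

/-- In a braided structure, the row of `cup ⊗ 1` at `p` would miss the word `p q p`. -/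
theorem false_of_braided [BraidedCategory (CrysTL k)] : False := by
  have h := congrArg entryMat (cup_whiskerRight_eq (k := k))
  simp only [entryMat_comp, entryMat_associator_hom,
    entryMat_associator_inv] at h
  have h' : tens (cupMat k) (1 : WMat k 1 1) = _ :=
    ((entryMat_whiskerRight (cup k) (gen k)).trans
      (congrArg (tens _) entryMat_id_gen)).symm.trans h
  -- Compare the coefficients of `pqp` in the images of `p`.
  have h₁ := congrFun (congrFun h' ![true]) ![true, false, true]
  have h₂ := exists_of_mul_ne_zero
    (h₁.symm.trans cup_tens_one_apply |>.trans_ne one_ne_zero)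
  -- The inverse braiding with the unit is the leftmost factor. Its value is irrelevant, since the
  -- remaining product vanishes at `pqp` in every row `v`.
  obtain ⟨v, -, hv⟩ := h₂
  refine hv (Eq.trans ?_ (mul_apply_eq_zero (entryMat
    (β_ (gen k) (gen k)).hom) (entryMat
    (β_ (gen k) (gen k)).hom) (isGraded_entryMat _)
    (w := v) (u := ![true, false, true]) rfl rfl))
  refine congrFun (congrFun (congrArg₂ _ ?_ ?_) _) _
  · exact (entryMat_whiskerLeft _ _).trans
      (congrArg (tens · _) entryMat_id_gen)
  -- The three identity factors removed here are the matrices of the associators.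
  · refine (Matrix.one_mul _).trans (congrArg₂ _ ?_ ((Matrix.one_mul _).trans
      ((Matrix.mul_one _).trans ?_)))
    · exact (entryMat_whiskerRight _ _).trans
        (congrArg (tens _) entryMat_id_gen)
    · exact (entryMat_whiskerLeft _ _).trans
        (congrArg (tens · _) entryMat_id_gen)

end WordMatrix

end

theorem mainTheorem9 (k : Type u) [Field k] : IsEmpty (BraidedCategory (CrysTL k)) :=
  ⟨fun _ => WordMatrix.false_of_braided (k := k)⟩
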